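/- Fix an arbitrary signature of finitary operation symbols. Algebras are nonempty, and a variety is a class of algebras of this signature closed under homomorphic images, subalgebras and direct products. An algebra $\mathbf{A}$ is *simple* if its only congruences are the equality relation and the total relation, and *strictly simple* if it is simple and every subalgebra of $\mathbf{A}$ is either $\mathbf{A}$ itself or a one-element algebra. A variety is *congruence-distributive* if the congruence lattice of each of its members is distributive. Let $\mathbf{A}$ be a finite strictly simple algebra and let $\mathsf{V}$ be the variety generated by $\mathbf{A}$, i.e., the least variety containing $\mathbf{A}$. If $\mathsf{V}$ is congruence-distributive, then $\mathsf{V}$ has the amalgamation property: for all $\mathbf{B},\mathbf{C},\mathbf{D}\in\mathsf{V}$ and all injective homomorphisms $\varphi_1\colon\mathbf{B}\to\mathbf{C}$ and $\varphi_2\colon\mathbf{B}\to\mathbf{D}$ there are $\mathbf{E}\in\mathsf{V}$ and injective homomorphisms $\psi_1\colon\mathbf{C}\to\mathbf{E}$ and $\psi_2\colon\mathbf{D}\to\mathbf{E}$ with $\psi_1\circ\varphi_1=\psi_2\circ\varphi_2$. -/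

import Mathlib

open scoped FirstOrder

universe u v w

namespace UniversalAlgebra

/-- A congruence of an `L`-algebra `M`: an equivalence relation on `M` that is compatible with
all basic operations. -/
structure Congruence (L : FirstOrder.Language.{u, v}) (M : Type w) [L.Structure M] extends Setoid M where
  map_fun' : ∀ {n : ℕ} (f : L.Functions n) (x y : Fin n → M),
    (∀ i, r (x i) (y i)) → r (FirstOrder.Language.Structure.funMap f x) (FirstOrder.Language.Structure.funMap f y)

namespace Congruence

variable {L : FirstOrder.Language.{u, v}} {M : Type w} [L.Structure M]

theorem toSetoid_injective :
    Function.Injective (Congruence.toSetoid : Congruence L M → Setoid M) := by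
  rintro ⟨s, hs⟩ ⟨t, ht⟩ h
  cases h
  rfl

/-- Congruences are ordered by inclusion (of sets of pairs). -/
instance : PartialOrder (Congruence L M) :=
  PartialOrder.lift Congruence.toSetoid toSetoid_injective

/-- Arbitrary meets of congruences are intersections. -/
instance : InfSet (Congruence L M) where
  sInf S :=
    { r := fun a b => ∀ c ∈ S, c.r a b
      iseqv :=
        { refl := fun a c _ => c.iseqv.refl a
          symm := fun h c hc => c.iseqv.symm (h c hc)
          trans := fun h h' c hc => c.iseqv.trans (h c hc) (h' c hc) }
      map_fun' := fun f x y h c hc => c.map_fun' f x y fun i => h i c hc }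

/-- The lattice `Con M` of congruences of `M`. Meets are intersections, `⊥` is equality, `⊤` is
the total relation, and the join of a set of congruences is the least congruence containing
all of them. -/
instance : CompleteLattice (Congruence L M) :=
  { completeLatticeOfInf (Congruence L M) (fun _ =>
      ⟨fun _ hc _ _ h => h _ hc, fun _ hd _ _ h c hc => hd hc h⟩) with
    inf := fun c d =>
      { r := fun a b => c.r a b ∧ d.r a b
        iseqv :=
          { refl := fun a => ⟨c.iseqv.refl a, d.iseqv.refl a⟩
            symm := fun h => ⟨c.iseqv.symm h.1, d.iseqv.symm h.2⟩
            trans := fun h h' => ⟨c.iseqv.trans h.1 h'.1, d.iseqv.trans h.2 h'.2⟩ }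
        map_fun' := fun f x y h =>
          ⟨c.map_fun' f x y fun i => (h i).1, d.map_fun' f x y fun i => (h i).2⟩ }
    inf_le_left := fun _ _ _ _ h => h.1
    inf_le_right := fun _ _ _ _ h => h.2
    le_inf := fun _ _ _ h h' _ _ hab => ⟨h hab, h' hab⟩
    bot :=
      { r := fun a b => a = b
        iseqv := eq_equivalence
        map_fun' := fun f _ _ h => congrArg (FirstOrder.Language.Structure.funMap f) (funext h) }
    bot_le := fun c a b h => (show a = b from h) ▸ c.iseqv.refl a
    top :=
      { r := fun _ _ => True
        iseqv := ⟨fun _ => trivial, fun _ => trivial, fun _ _ => trivial⟩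
        map_fun' := fun _ _ _ _ => trivial }
    le_top := fun _ _ _ _ => trivial }

end Congruence

/-- The direct product of a family of `L`-structures, with coordinatewise operations. -/
instance piStructure (L : FirstOrder.Language.{u, v}) {ι : Type w} (M : ι → Type w)
    [∀ i, L.Structure (M i)] : L.Structure (∀ i, M i) where
  funMap f x := fun i => FirstOrder.Language.Structure.funMap f fun k => x k i
  RelMap r x := ∀ i, FirstOrder.Language.Structure.RelMap r fun k => x k i

/-- A variety: a class of (nonempty) algebras of a fixed signature that is closed under
homomorphic images, subalgebras and direct products. -/
structure IsVariety {L : FirstOrder.Language.{u, v}} (V : Set (CategoryTheory.Bundled.{w} L.Structure)) : Prop where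
  nonempty : ∀ M ∈ V, Nonempty M
  hom_image : ∀ M ∈ V, ∀ (N : CategoryTheory.Bundled.{w} L.Structure) (f : M →[L] N),
    Function.Surjective f → N ∈ V
  subalgebra : ∀ M ∈ V, ∀ S : L.Substructure M, (S : Set M).Nonempty →
    (⟨S, inferInstance⟩ : CategoryTheory.Bundled.{w} L.Structure) ∈ V
  product : ∀ (ι : Type w) (M : ι → CategoryTheory.Bundled.{w} L.Structure), (∀ i, M i ∈ V) →
    (⟨∀ i, M i, piStructure L fun i => M i⟩ : CategoryTheory.Bundled.{w} L.Structure) ∈ V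

/-- `V` is the variety generated by the algebra `A`: the least variety that contains `A`. -/
def IsVarietyGeneratedBy {L : FirstOrder.Language.{u, v}} (V : Set (CategoryTheory.Bundled.{w} L.Structure))
    (A : CategoryTheory.Bundled.{w} L.Structure) : Prop :=
  IsLeast {K : Set (CategoryTheory.Bundled.{w} L.Structure) | IsVariety K ∧ A ∈ K} V

/-- A class of algebras is congruence-distributive if every member has a distributive
congruence lattice. -/
def CongruenceDistributive {L : FirstOrder.Language.{u, v}} (V : Set (CategoryTheory.Bundled.{w} L.Structure)) : Prop :=
  ∀ M ∈ V, ∀ a b c : Congruence L M, a ⊓ (b ⊔ c) = (a ⊓ b) ⊔ (a ⊓ c)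

/-- An algebra is simple if its only congruences are equality and the total relation. -/
def IsSimpleAlgebra (L : FirstOrder.Language.{u, v}) (M : Type w) [L.Structure M] : Prop :=
  ∀ c : Congruence L M, c = ⊥ ∨ c = ⊤

/-- An algebra is strictly simple if it is simple and has no proper subalgebra with more than
one element. -/
def IsStrictlySimple (L : FirstOrder.Language.{u, v}) (M : Type w) [L.Structure M] : Prop :=
  IsSimpleAlgebra L M ∧ ∀ S : L.Substructure M, (S : Set M).Subsingleton ∨ S = ⊤

end UniversalAlgebra

/-!
Every algebra `M` of the variety `V` has enough homomorphisms to `A` to separate its points, and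
this determines how homomorphisms to `A` extend from subalgebras.

The engine is Jónsson's argument. Let `p i : M →[L] A` be a jointly injective family on some
`M ∈ V`, and let `θ` be a congruence of `M` that is maximal among those not identifying two given
elements. As `Con M` is distributive, `θ` is meet-prime, so the sets `J` of indices with
`⨅ i ∈ J, ker (p i) ≤ θ` contain an ultrafilter `U` (`exists_ultrafilter_ker_le`). As `A` is
finite, the `p i` have a pointwise limit `q : M →[L] A` along `U` (`exists_ultralimit`), and
`ker q ≤ θ`. The range of `q` has more than one element, so `q` is onto `A`, and simplicity of `A`
gives `ker q = θ` (`exists_ultrafilter_eq`).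

* Hence the members of `V` whose points are separated by homomorphisms to `A` are closed under
  homomorphic images, so they form a variety and exhaust `V` (`separatesPoints_of_mem`).
* Let `M` embed in `P` and let `g : M →[L] A` be a homomorphism. If `g` is constant, its value is
  an idempotent of `A`, and the constant map extends `g`. Otherwise the argument above, applied to
  `θ = ker g` and to the restrictions to `M` of all homomorphisms from `P` to `A`, shows that `g`
  factors through the restriction of an ultralimit of homomorphisms on `P`, so it extends to `P`
  (`exists_extension`).

The amalgam of `N` and `P` over `M` is the power of `A` indexed by the pairs of homomorphisms
`N →[L] A` and `P →[L] A` that agree on `M`.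
-/

namespace UniversalAlgebra

open FirstOrder.Language FirstOrder.Language.Structure Filter

variable {L : FirstOrder.Language.{u, v}}

/-! ### Kernels and images of congruences -/

/-- The kernel of a homomorphism, as a congruence of its domain. -/
def Congruence.ker {M N : Type*} [L.Structure M] [L.Structure N] (f : M →[L] N) :
    Congruence L M where
  r a b := f a = f b
  iseqv := ⟨fun _ => rfl, fun h => h.symm, fun h h' => h.trans h'⟩
  map_fun' g x y h := by
    rw [f.map_fun, f.map_fun]
    exact congrArg _ (funext h)

/-- The image of a congruence `θ` under a surjective homomorphism whose kernel is below `θ`. -/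
def Congruence.map {M N : Type*} [L.Structure M] [L.Structure N] (f : M →[L] N)
    (hf : Function.Surjective f) (θ : Congruence L M) (hθ : Congruence.ker f ≤ θ) :
    Congruence L N where
  r a b := ∃ s t, f s = a ∧ f t = b ∧ θ.r s t
  iseqv :=
    { refl := fun a => (hf a).elim fun s hs => ⟨s, s, hs, hs, θ.iseqv.refl s⟩
      symm := fun ⟨s, t, hs, ht, h⟩ => ⟨t, s, ht, hs, θ.iseqv.symm h⟩
      trans := fun ⟨s, t, hs, ht, h⟩ ⟨s', t', hs', ht', h'⟩ =>
        ⟨s, t', hs, ht', θ.iseqv.trans h (θ.iseqv.trans (hθ (ht.trans hs'.symm)) h')⟩ }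
  map_fun' g x y h := by
    choose s t hs ht hst using h
    refine ⟨funMap g s, funMap g t, ?_, ?_, θ.map_fun' g s t hst⟩
    · rw [f.map_fun]
      exact congrArg _ (funext hs)
    · rw [f.map_fun]
      exact congrArg _ (funext ht)

/-- The homomorphisms from `M` to `A` separate the points of `M`, i.e. `M` embeds into a power
of `A`. -/
def SeparatesPoints (L : FirstOrder.Language.{u, v}) (M A : Type*) [L.Structure M]
    [L.Structure A] : Prop :=
  ∀ a b : M, a ≠ b → ∃ f : M →[L] A, f a ≠ f b

/-! ### Homomorphisms to a finite strictly simple algebra -/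

section Homs

variable {M N A : Type*} [L.Structure M] [L.Structure N] [L.Structure A]

theorem surjective_of_ne (hA : IsStrictlySimple L A) (f : M →[L] A) {s t : M} (h : f s ≠ f t) :
    Function.Surjective f := by
  rcases hA.2 f.range with hS | hS
  · exact absurd (hS ⟨s, rfl⟩ ⟨t, rfl⟩) h
  · exact FirstOrder.Language.Hom.range_eq_top.1 hS

/-- A congruence above the kernel of a homomorphism onto a simple algebra equals that kernel,
unless it is total. -/
theorem eq_of_ker_le (hA : IsSimpleAlgebra L A) (q : M →[L] A) (hq : Function.Surjective q)
    (θ : Congruence L M) (hθ : Congruence.ker q ≤ θ) {a b : M} (hab : ¬ θ.r a b) {s t : M}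
    (hst : θ.r s t) : q s = q t := by
  rcases hA (Congruence.map q hq θ hθ) with h | h
  · have : (Congruence.map q hq θ hθ).r (q s) (q t) := ⟨s, t, rfl, rfl, hst⟩
    rw [h] at this
    exact this
  · have : (Congruence.map q hq θ hθ).r (q a) (q b) := by
      rw [h]
      trivial
    obtain ⟨a', b', ha, hb, h'⟩ := this
    exact absurd (θ.iseqv.trans (hθ ha.symm) (θ.iseqv.trans h' (hθ hb))) hab

variable [L.IsAlgebraic]

theorem exists_factor_of_surjective (f : M →[L] N) (hf : Function.Surjective f) (g : M →[L] A)
    (h : ∀ s t, f s = f t → g s = g t) : ∃ k : N →[L] A, ∀ s, k (f s) = g s := by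
  have key : ∀ s, g (Function.surjInv hf (f s)) = g s := fun s =>
    h _ _ (Function.surjInv_eq hf (f s))
  refine ⟨⟨fun n => g (Function.surjInv hf n), fun {n} F x => ?_, fun r => isEmptyElim r⟩, key⟩
  obtain ⟨y, rfl⟩ : ∃ y : Fin n → M, x = f ∘ y :=
    ⟨fun i => Function.surjInv hf (x i), funext fun i => (Function.surjInv_eq hf (x i)).symm⟩
  rw [← f.map_fun, key, g.map_fun]
  exact congrArg _ (funext fun i => (key (y i)).symm)

/-- Homomorphisms into a finite algebra have a pointwise limit along any ultrafilter, and the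
limit is a homomorphism. -/
theorem exists_ultralimit [Finite A] {ι : Type*} (U : Ultrafilter ι) (p : ι → M →[L] A) :
    ∃ q : M →[L] A, ∀ s, ∀ᶠ i in U, p i s = q s := by
  have h : ∀ s, ∃ a, ∀ᶠ i in U, p i s = a := fun s => by
    obtain ⟨a, ha⟩ := Ultrafilter.eq_pure_of_finite (U.map fun i => p i s)
    refine ⟨a, ?_⟩
    have : ({a} : Set A) ∈ U.map fun i => p i s := by
      rw [ha]
      exact Set.mem_singleton a
    exact this
  choose q hq using h
  refine ⟨⟨q, fun F x => ?_, fun r => isEmptyElim r⟩, hq⟩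
  obtain ⟨i, hi, hi'⟩ := ((hq (funMap F x)).and (eventually_all.2 fun k => hq (x k))).exists
  rw [← hi, (p i).map_fun]
  exact congrArg _ (funext hi')

end Homs

/-! ### Jónsson's lemma -/

section Jonsson

variable {M A : Type*} [L.Structure M] [L.Structure A]

/-- In a distributive congruence lattice, a congruence that is maximal among those not
identifying `a` and `b` is meet-prime. -/
theorem le_or_le_of_inf_le
    (hd : ∀ a b c : Congruence L M, a ⊓ (b ⊔ c) = (a ⊓ b) ⊔ (a ⊓ c))
    {θ : Congruence L M} {a b : M} (hab : ¬ θ.r a b)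
    (hmax : ∀ c : Congruence L M, θ ≤ c → ¬ c.r a b → c ≤ θ) (c d : Congruence L M)
    (h : c ⊓ d ≤ θ) : c ≤ θ ∨ d ≤ θ := by
  by_contra! hcon
  have aux : ∀ c : Congruence L M, ¬ c ≤ θ → (θ ⊔ c).r a b := fun c hc =>
    by_contra fun hn => hc (le_sup_right.trans (hmax _ le_sup_left hn))
  have hle : (θ ⊔ c) ⊓ (θ ⊔ d) ≤ θ := by
    rw [hd, inf_comm (θ ⊔ c) d, hd]
    exact sup_le inf_le_right (sup_le inf_le_right ((inf_comm d c).le.trans h))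
  exact hab (hle ⟨aux c hcon.1, aux d hcon.2⟩)

/-- The ultrafilter of Jónsson's lemma: if the `p i` separate points and `θ` is a proper
meet-prime congruence, then elements with equal images under almost all `p i` are identified
by `θ`. -/
theorem exists_ultrafilter_ker_le {ι : Type*} (p : ι → M →[L] A)
    (hp : ∀ s t, (∀ i, p i s = p i t) → s = t) {θ : Congruence L M}
    (hθ : ∀ c d : Congruence L M, c ⊓ d ≤ θ → c ≤ θ ∨ d ≤ θ) {a b : M} (hab : ¬ θ.r a b) :
    ∃ U : Ultrafilter ι, ∀ s t, (∀ᶠ i in U, p i s = p i t) → θ.r s t := by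
  let κ : Set ι → Congruence L M := fun J => ⨅ i ∈ J, Congruence.ker (p i)
  have κr : ∀ J s t, (κ J).r s t ↔ ∀ i ∈ J, p i s = p i t := by
    intro J s t
    constructor
    · intro h i hi
      exact (show κ J ≤ Congruence.ker (p i) from iInf₂_le i hi) h
    · intro h
      let c : Congruence L M :=
        { r := fun s t => ∀ i ∈ J, p i s = p i t
          iseqv := ⟨fun _ _ _ => rfl, fun h i hi => (h i hi).symm,
            fun h h' i hi => (h i hi).trans (h' i hi)⟩
          map_fun' := fun f x y h i hi => (Congruence.ker (p i)).map_fun' f x y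
            fun k => h k i hi }
      exact (show c ≤ κ J from le_iInf₂ fun i hi _ _ h => h i hi) h
  have κ_anti : ∀ {J K}, J ⊆ K → κ K ≤ κ J := fun h => biInf_mono h
  -- The complements of the sets `J` with `κ J ≰ θ` form a proper filter; an ultrafilter above it
  -- contains only sets `J` with `κ J ≤ θ`.
  let F : Filter ι :=
    { sets := {J | ¬ κ Jᶜ ≤ θ}
      univ_sets := fun h => hab (h ((κr _ _ _).2 fun i hi => absurd (Set.mem_univ i) hi))
      sets_of_superset := fun hJ hJK h => hJ ((κ_anti (Set.compl_subset_compl.2 hJK)).trans h)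
      inter_sets := fun {J K} hJ hK h => by
        refine (hθ (κ Jᶜ) (κ Kᶜ) fun s t hst => h ((κr _ _ _).2 fun i hi => ?_)).elim hJ hK
        rw [Set.compl_inter] at hi
        exact hi.elim ((κr _ _ _).1 hst.1 i) ((κr _ _ _).1 hst.2 i) }
  have hF : F.NeBot := by
    refine ⟨fun h => ?_⟩
    have : ¬ κ (∅ : Set ι)ᶜ ≤ θ := (h ▸ mem_bot : (∅ : Set ι) ∈ F)
    refine this fun s t hst => ?_
    rw [hp s t fun i => (κr _ _ _).1 hst i (Set.notMem_empty i)]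
  refine ⟨Ultrafilter.of F, fun s t hst => ?_⟩
  by_contra hn
  have hmem : {i | p i s = p i t}ᶜ ∈ F := fun h => hn (h ((κr _ _ _).2 fun i hi => by
    rw [compl_compl] at hi
    exact hi))
  exact Ultrafilter.compl_notMem_iff.2 hst (Ultrafilter.of_le F hmem)

/-- Jónsson's lemma for a finite strictly simple algebra `A`: a congruence `θ` that is maximal
among those not identifying `a` and `b` is the kernel of an ultralimit of the given homomorphisms
to `A`. -/
theorem exists_ultrafilter_eq [L.IsAlgebraic] [Finite A] (hA : IsStrictlySimple L A)
    (hd : ∀ a b c : Congruence L M, a ⊓ (b ⊔ c) = (a ⊓ b) ⊔ (a ⊓ c))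
    {ι : Type*} (p : ι → M →[L] A) (hp : ∀ s t, (∀ i, p i s = p i t) → s = t)
    {θ : Congruence L M} {a b : M} (hab : ¬ θ.r a b)
    (hmax : ∀ c : Congruence L M, θ ≤ c → ¬ c.r a b → c ≤ θ) :
    ∃ U : Ultrafilter ι, ∀ q : M →[L] A, (∀ s, ∀ᶠ i in U, p i s = q s) →
      Function.Surjective q ∧ ∀ s t, q s = q t ↔ θ.r s t := by
  obtain ⟨U, hU⟩ := exists_ultrafilter_ker_le p hp (le_or_le_of_inf_le hd hab hmax) hab
  refine ⟨U, fun q hq => ?_⟩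
  have hle : Congruence.ker q ≤ θ := fun s t hst => hU s t <| by
    filter_upwards [hq s, hq t] with i hs ht
    rw [hs, ht]
    exact hst
  have hsurj : Function.Surjective q := surjective_of_ne hA q fun h => hab (hle h)
  exact ⟨hsurj, fun s t => ⟨fun h => hle h, fun h => eq_of_ker_le hA.1 q hsurj θ hle hab h⟩⟩

theorem exists_maximal_congruence (θ₀ : Congruence L M) {a b : M} (hab : ¬ θ₀.r a b) :
    ∃ θ : Congruence L M, θ₀ ≤ θ ∧ ¬ θ.r a b ∧
      ∀ c : Congruence L M, θ ≤ c → ¬ c.r a b → c ≤ θ := by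
  obtain ⟨θ, hθ, hmax⟩ := zorn_le_nonempty₀ {c : Congruence L M | ¬ c.r a b} (by
    intro C hC hchain y hy
    have hdir : DirectedOn (· ≤ ·) C := hchain.directedOn
    let σ : Congruence L M :=
      { r := fun s t => ∃ c ∈ C, c.r s t
        iseqv :=
          { refl := fun s => ⟨y, hy, y.iseqv.refl s⟩
            symm := fun ⟨c, hc, h⟩ => ⟨c, hc, c.iseqv.symm h⟩
            trans := fun ⟨c, hc, h⟩ ⟨d, hd, h'⟩ => by
              obtain ⟨e, he, hce, hde⟩ := hdir c hc d hd
              exact ⟨e, he, e.iseqv.trans (hce h) (hde h')⟩ }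
        map_fun' := fun {n} f x z h => by
          choose c hc hr using h
          -- Finitely many members of the chain have an upper bound in it.
          obtain ⟨e, he, hle⟩ : ∃ e ∈ C, ∀ i, c i ≤ e := by
            have : Nonempty C := ⟨⟨y, hy⟩⟩
            have hdir' : Directed (· ≤ ·) (fun x : C => (x : Congruence L M)) :=
              directedOn_iff_directed.1 hdir
            obtain ⟨e, he⟩ := hdir'.finite_le fun i => (⟨c i, hc i⟩ : C)
            exact ⟨e, e.2, he⟩
          exact ⟨e, he, e.map_fun' f x z fun i => hle i (hr i)⟩ }
    exact ⟨σ, fun ⟨c, hc, h⟩ => hC hc h, fun c hc s t h => ⟨c, hc, h⟩⟩) θ₀ hab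
  exact ⟨θ, hθ, hmax.prop, fun c hc h => hmax.le_of_ge h hc⟩

end Jonsson

/-! ### Separation of points and extension of homomorphisms in the variety -/

section Variety

variable [L.IsAlgebraic] {A : CategoryTheory.Bundled.{w} L.Structure} [Finite A]
  {V : Set (CategoryTheory.Bundled.{w} L.Structure)}

theorem separatesPoints_of_mem (hA : IsStrictlySimple L A) (hV : IsVarietyGeneratedBy V A)
    (hCD : CongruenceDistributive V) {M : CategoryTheory.Bundled.{w} L.Structure} (hM : M ∈ V) :
    SeparatesPoints L M A := by
  obtain ⟨⟨hvar, hAV⟩, hleast⟩ := hV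
  let K : Set (CategoryTheory.Bundled.{w} L.Structure) := {M | M ∈ V ∧ SeparatesPoints L M A}
  suffices h : IsVariety K ∧ A ∈ K from (hleast h hM).2
  refine ⟨⟨fun M hM => hvar.nonempty M hM.1, ?_, ?_, ?_⟩, hAV, fun a b h => ⟨.id L A, h⟩⟩
  · rintro M ⟨hM, hsep⟩ N f hf
    refine ⟨hvar.hom_image M hM N f hf, fun a' b' hne => ?_⟩
    obtain ⟨a, rfl⟩ := hf a'
    obtain ⟨b, rfl⟩ := hf b'
    obtain ⟨θ, hfθ, hab, hmax⟩ := exists_maximal_congruence (Congruence.ker f) hne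
    obtain ⟨U, hU⟩ := exists_ultrafilter_eq hA (hCD M hM) (fun g : M →[L] A => g)
      (fun s t h => by
        by_contra hst
        obtain ⟨g, hg⟩ := hsep s t hst
        exact hg (h g)) hab hmax
    obtain ⟨q, hq⟩ := exists_ultralimit U fun g : M →[L] A => g
    obtain ⟨k, hk⟩ := exists_factor_of_surjective f hf q fun s t h =>
      ((hU q hq).2 s t).2 (hfθ h)
    refine ⟨k, fun h => hab (((hU q hq).2 a b).1 ?_)⟩
    rwa [hk, hk] at h
  · rintro M ⟨hM, hsep⟩ S hS
    refine ⟨hvar.subalgebra M hM S hS, fun a b hne => ?_⟩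
    obtain ⟨g, hg⟩ := hsep a.1 b.1 fun h => hne (Subtype.ext h)
    exact ⟨g.comp S.subtype.toHom, hg⟩
  · intro ι M hM
    refine ⟨hvar.product ι M fun i => (hM i).1, fun a b hne => ?_⟩
    obtain ⟨i, hi⟩ := Function.ne_iff.1 hne
    obtain ⟨g, hg⟩ := (hM i).2 (a i) (b i) hi
    exact ⟨⟨fun x => g (x i), fun F x => g.map_fun F fun k => x k i, fun r => isEmptyElim r⟩, hg⟩

/-- `A` is injective relative to embeddings between members of `V`. -/
theorem exists_extension (hA : IsStrictlySimple L A) (hV : IsVarietyGeneratedBy V A)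
    (hCD : CongruenceDistributive V) {M P : CategoryTheory.Bundled.{w} L.Structure} (hM : M ∈ V)
    (hP : P ∈ V) (e : M ↪[L] P) (g : M →[L] A) : ∃ h : P →[L] A, ∀ m, h (e m) = g m := by
  by_cases hg : ∃ a b, g a ≠ g b
  · obtain ⟨a, b, hab⟩ := hg
    have hgs : Function.Surjective g := surjective_of_ne hA g hab
    obtain ⟨U, hU⟩ := exists_ultrafilter_eq hA (hCD M hM) (fun h : P →[L] A => h.comp e.toHom)
      (fun s t h => by
        by_contra hst
        obtain ⟨k, hk⟩ := separatesPoints_of_mem hA hV hCD hP (e s) (e t)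
          fun h => hst (e.injective h)
        exact hk (h k))
      (θ := Congruence.ker g) hab
      fun c hc hn s t hst => eq_of_ker_le hA.1 g hgs c hc hn hst
    obtain ⟨q, hq⟩ := exists_ultralimit U fun h : P →[L] A => h
    obtain ⟨hs, hker⟩ := hU (q.comp e.toHom) fun s => hq (e s)
    obtain ⟨α, hα⟩ := exists_factor_of_surjective (q.comp e.toHom) hs g
      fun s t h => (hker s t).1 h
    exact ⟨α.comp q, hα⟩
  · push Not at hg
    obtain ⟨m⟩ := hV.1.1.nonempty M hM
    refine ⟨⟨fun _ => g m, fun F x => ?_, fun r => isEmptyElim r⟩, fun m' => hg m m'⟩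
    exact (hg m (funMap F fun _ => m)).trans (g.map_fun F fun _ => m)

end Variety

/-! ### Amalgamation -/

/-- The embedding into a power of `A` whose coordinates are the members of a family of
homomorphisms that separates points. -/
def powerEmbedding [L.IsAlgebraic] {M : Type*} {A ι : Type w} [L.Structure M]
    [L.Structure A] (p : ι → M →[L] A) (hp : ∀ s t, (∀ i, p i s = p i t) → s = t) :
    letI := piStructure L fun _ : ι => A
    M ↪[L] (ι → A) :=
  letI := piStructure L fun _ : ι => A
  { toFun := fun m i => p i m
    inj' := fun s t h => hp s t (congrFun h)
    map_fun' := fun F x => funext fun i => (p i).map_fun F x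
    map_rel' := fun r => isEmptyElim r }

end UniversalAlgebra

open UniversalAlgebra in
theorem proposition3p11 {L : FirstOrder.Language.{u, v}} [L.IsAlgebraic]
    (A : CategoryTheory.Bundled.{w} L.Structure) [Nonempty A] [Finite A]
    (hA : UniversalAlgebra.IsStrictlySimple L A)
    (V : Set (CategoryTheory.Bundled.{w} L.Structure))
    (hV : UniversalAlgebra.IsVarietyGeneratedBy V A)
    (hCD : UniversalAlgebra.CongruenceDistributive V) :
    FirstOrder.Language.Amalgamation V := by
  intro M N P MN MP hM hN hP
  let ι : Type w := {i : (N →[L] A) × (P →[L] A) // ∀ m, i.1 (MN m) = i.2 (MP m)}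
  refine ⟨⟨ι → A, piStructure L fun _ => A⟩,
    powerEmbedding (fun i : ι => i.1.1) fun s t h => ?_,
    powerEmbedding (fun i : ι => i.1.2) fun s t h => ?_,
    hV.1.1.product ι (fun _ => A) fun _ => hV.1.2, ?_⟩
  · by_contra hst
    obtain ⟨g, hg⟩ := separatesPoints_of_mem hA hV hCD hN s t hst
    obtain ⟨k, hk⟩ := exists_extension hA hV hCD hM hP MP (g.comp MN.toHom)
    exact hg (h ⟨(g, k), fun m => (hk m).symm⟩)
  · by_contra hst
    obtain ⟨g, hg⟩ := separatesPoints_of_mem hA hV hCD hP s t hst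
    obtain ⟨k, hk⟩ := exists_extension hA hV hCD hM hN MN (g.comp MP.toHom)
    exact hg (h ⟨(k, g), hk⟩)
  · exact FirstOrder.Language.Embedding.ext fun m => funext fun i : ι => i.2 m
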